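/- All Hilbert spaces are finite-dimensional, $\mathcal S(\mathcal H)$ denotes the density matrices on $\mathcal H$, and a channel on $\mathcal H$ is a completely positive trace-preserving linear map. A *resource theory* on $\mathcal H$ is a pair $(S,F)$ of a set $S\subseteq\mathcal S(\mathcal H)$ of free states and a set $F$ of channels on $\mathcal H$ such that $F$ contains the identity, is closed under composition, and $\Lambda(\rho)\in S$ for all $\Lambda\in F$, $\rho\in S$. Let $(S^{(i)},F^{(i)})$ be resource theories on $\mathcal H^{(i)}$ for finitely many parties $i$, and let $\operatorname{Tr}_{\bar i}$ be the partial trace over all parties except the $i$-th. A resource theory $(S,F)$ on $\bigotimes_i\mathcal H^{(i)}$ is *composite* if (a) $\bigotimes_i\rho^{(i)}\in S$ whenever $\rho^{(i)}\in S^{(i)}$ for all $i$; (b) $\bigotimes_i\Lambda^{(i)}\in F$ whenever $\Lambda^{(i)}\in F^{(i)}$ for all $i$; (c) $\operatorname{Tr}_{\bar i}\rho\in S^{(i)}$ for all $\rho\in S$ and all $i$; (d) for all $\Lambda\in F$, all $i$, and all $\rho^{(j)}\in S^{(j)}$ ($j\ne i$), the map $X\mapsto\operatorname{Tr}_{\bar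 i}\Lambda\big(X^{(i)}\otimes\bigotimes_{j\neq i}\rho^{(j)}\big)$ belongs to $F^{(i)}$. Put $S_{\min}=\operatorname{conv}\{\bigotimes_i\rho^{(i)} : \rho^{(i)}\in S^{(i)}\}$ and $S_{\max}=\{\rho\in\mathcal S(\bigotimes_i\mathcal H^{(i)}) : \operatorname{Tr}_{\bar i}\rho\in S^{(i)}\text{ for all }i\}$. Let $D(\rho\|\sigma)=\operatorname{Tr}\rho(\log_2\rho-\log_2\sigma)$ if $\operatorname{supp}\rho\subseteq\operatorname{supp}\sigma$ and $D(\rho\|\sigma)=+\infty$ otherwise, and for a set $M$ of states let $D(\rho\|M)=\inf_{\mu\in M}D(\rho\|\mu)$ (with $\inf\emptyset=+\infty$). **Statement.** Let $(S,F)$ be a composite resource theory of $(S^{(i)},F^{(i)})$, and let $\rho=\bigotimes_i\rho^{(i)}$ be a product of density matrices such that $\rho^{(i)}\in S^{(i)}$ for every $i\neq 1$, where $1$ is any fixed party. Then $$D(\rho\|S)=D(\rho\|S_{\max})=D(\rho^{(1)}\|S^{(1)}),$$ and, if $S^{(1)}$ is convex (in particular, for convex resource theories), also $$D(\rho\|S_{\min})=D(\rho^{(1)}\|S^{(1)}).$$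 -/

import Mathlib

open scoped Matrix ComplexOrder

namespace Composite

/-- A density matrix on `ℂ^a`: positive semidefinite with unit trace. -/
def IsDensity {a : Type*} [Fintype a] (ρ : Matrix a a ℂ) : Prop :=
  ρ.PosSemidef ∧ ρ.trace = 1

/-- The map `id_k ⊗ Λ` on `k × k` block matrices with blocks in `Matrix a a ℂ`:
`Λ` is applied to every block. -/
def blockMap {a : Type*} (k : ℕ) (Λ : Matrix a a ℂ →ₗ[ℂ] Matrix a a ℂ)
    (M : Matrix (Fin k × a) (Fin k × a) ℂ) : Matrix (Fin k × a) (Fin k × a) ℂ :=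
  Matrix.of fun p q => Λ (Matrix.of fun x y => M (p.1, x) (q.1, y)) p.2 q.2

/-- A quantum channel: a completely positive, trace-preserving linear map. -/
def IsChannel {a : Type*} [Fintype a] (Λ : Matrix a a ℂ →ₗ[ℂ] Matrix a a ℂ) : Prop :=
  (∀ (k : ℕ) (M : Matrix (Fin k × a) (Fin k × a) ℂ), M.PosSemidef → (blockMap k Λ M).PosSemidef) ∧
    ∀ X : Matrix a a ℂ, (Λ X).trace = X.trace

/-- A resource theory on `ℂ^a`: a set `S` of free states and a set `F` of free operations that
contains the identity channel, is closed under concatenation and maps `S` into `S`. -/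
structure ResourceTheory (a : Type*) [Fintype a] where
  S : Set (Matrix a a ℂ)
  F : Set (Matrix a a ℂ →ₗ[ℂ] Matrix a a ℂ)
  isDensity_of_mem : ∀ ρ ∈ S, IsDensity ρ
  isChannel_of_mem : ∀ Λ ∈ F, IsChannel Λ
  id_mem : LinearMap.id ∈ F
  comp_mem : ∀ Λ ∈ F, ∀ Λ' ∈ F, Λ ∘ₗ Λ' ∈ F
  map_mem : ∀ Λ ∈ F, ∀ ρ ∈ S, Λ ρ ∈ S

section Parties

variable {ι : Type*} [Fintype ι] {d : ι → Type*}

/-- The tensor product `⨂ i, A i`, in the product basis indexed by `∀ i, d i`. -/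
def tensor (A : ∀ i, Matrix (d i) (d i) ℂ) : Matrix (∀ i, d i) (∀ i, d i) ℂ :=
  Matrix.of fun x y => ∏ i, A i (x i) (y i)

variable [DecidableEq ι]

/-- The linear map `X ↦ X⁽ⁱ⁾ ⊗ ⨂ j ≠ i, ρ j`. The matrix `ρ i` plays no role. -/
def insertMap (i : ι) (ρ : ∀ j, Matrix (d j) (d j) ℂ) :
    Matrix (d i) (d i) ℂ →ₗ[ℂ] Matrix (∀ j, d j) (∀ j, d j) ℂ where
  toFun X := Matrix.of fun x y =>
    X (x i) (y i) * ∏ j ∈ Finset.univ.erase i, ρ j (x j) (y j)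
  map_add' X Y := by ext x y; simp [add_mul]
  map_smul' c X := by ext x y; simp [mul_assoc]

variable [∀ i, Fintype (d i)] [∀ i, DecidableEq (d i)]

/-- The partial trace over all parties except the `i`-th one: the `(a, b)` entry sums the entries
of `X` at those pairs of indices which agree off `i` and have `i`-th coordinates `a`, `b`. -/
def marginal (i : ι) :
    Matrix (∀ j, d j) (∀ j, d j) ℂ →ₗ[ℂ] Matrix (d i) (d i) ℂ where
  toFun X := Matrix.of fun a b =>
    ∑ x : ∀ j, d j, if x i = a then X x (Function.update x i b) else 0
  map_add' X Y := by
    ext a b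
    simp only [Matrix.of_apply, Matrix.add_apply, ← Finset.sum_add_distrib]
    refine Finset.sum_congr rfl fun x _ => ?_
    split_ifs <;> simp
  map_smul' c X := by
    ext a b
    simp only [Matrix.of_apply, Matrix.smul_apply, RingHom.id_apply, smul_eq_mul,
      Finset.mul_sum, mul_ite, mul_zero]

/-- The tensor product `⨂ i, Λ i` of linear maps: the linear map that sends the matrix unit
`|x⟩⟨y| = ⨂ i, |x i⟩⟨y i|` to `⨂ i, Λ i (|x i⟩⟨y i|)`. -/
def tensorMap (Λ : ∀ i, Matrix (d i) (d i) ℂ →ₗ[ℂ] Matrix (d i) (d i) ℂ) :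
    Matrix (∀ i, d i) (∀ i, d i) ℂ →ₗ[ℂ] Matrix (∀ i, d i) (∀ i, d i) ℂ where
  toFun X := ∑ x : ∀ i, d i, ∑ y : ∀ i, d i,
    X x y • tensor fun i => Λ i (Matrix.single (x i) (y i) 1)
  map_add' X Y := by
    simp only [Matrix.add_apply, add_smul, Finset.sum_add_distrib]
  map_smul' c X := by
    simp only [Matrix.smul_apply, smul_eq_mul, mul_smul, RingHom.id_apply, Finset.smul_sum]

/-- `T` is a composite resource theory of the local resource theories `L i`. -/
structure IsComposite (L : ∀ i, ResourceTheory (d i)) (T : ResourceTheory (∀ i, d i)) :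
    Prop where
  free_product_states : ∀ ρ : ∀ i, Matrix (d i) (d i) ℂ,
    (∀ i, ρ i ∈ (L i).S) → tensor ρ ∈ T.S
  free_product_operations : ∀ Λ : ∀ i, Matrix (d i) (d i) ℂ →ₗ[ℂ] Matrix (d i) (d i) ℂ,
    (∀ i, Λ i ∈ (L i).F) → tensorMap Λ ∈ T.F
  free_marginal_states : ∀ ρ ∈ T.S, ∀ i, marginal i ρ ∈ (L i).S
  free_marginal_operations : ∀ Λ ∈ T.F, ∀ (i : ι) (ρ : ∀ j, Matrix (d j) (d j) ℂ),
    (∀ j, j ≠ i → ρ j ∈ (L j).S) → marginal i ∘ₗ Λ ∘ₗ insertMap i ρ ∈ (L i).F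

/-- The minimal composite free states: the convex hull of the products of free states. -/
def Smin (L : ∀ i, ResourceTheory (d i)) : Set (Matrix (∀ i, d i) (∀ i, d i) ℂ) :=
  convexHull ℝ {σ | ∃ ρ : ∀ i, Matrix (d i) (d i) ℂ, (∀ i, ρ i ∈ (L i).S) ∧ σ = tensor ρ}

/-- The maximal composite free states: the states all of whose one-party marginals are free. -/
def Smax (L : ∀ i, ResourceTheory (d i)) : Set (Matrix (∀ i, d i) (∀ i, d i) ℂ) :=
  {ρ | IsDensity ρ ∧ ∀ i, marginal i ρ ∈ (L i).S}

end Parties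

open Classical in
/-- The quantum relative entropy `D(ρ‖σ) = Tr ρ (log ρ - log σ)` (logarithm to base 2) of density
matrices, which is `+∞` unless `supp ρ ⊆ supp σ`, that is, `ker σ ⊆ ker ρ`. The convention
`Real.logb 2 0 = 0` makes the functional calculus below the logarithm on the support and zero on
the kernel. -/
noncomputable def relEntropy {a : Type*} [Fintype a] [DecidableEq a] (ρ σ : Matrix a a ℂ) :
    EReal :=
  if ∀ v : a → ℂ, σ *ᵥ v = 0 → ρ *ᵥ v = 0 then
    (((ρ * (cfc (Real.logb 2) ρ - cfc (Real.logb 2) σ)).trace.re : ℝ) : EReal)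
  else ⊤

/-- The relative entropy of a resource `D(ρ‖S) = inf_{μ ∈ S} D(ρ‖μ)`, equal to `+∞` for empty
`S`. -/
noncomputable def relEntropySet {a : Type*} [Fintype a] [DecidableEq a] (ρ : Matrix a a ℂ)
    (S : Set (Matrix a a ℂ)) : EReal :=
  ⨅ μ ∈ S, relEntropy ρ μ

end Composite

/-!
The whole content is the inequality `D(ρ i ‖ marginal i σ) ≤ D(tensor ρ ‖ σ)` for a *product* state
in the first argument and an arbitrary state `σ` in the second (`relEntropy_marginal_le`), together
with the reverse bound for `σ = tensor (update ρ i μ)` (`relEntropy_tensor_update_le`). They pin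
down the infimum over every set of states whose `i`-th marginals are free and which contains the
products of free states with the other factors of `ρ` (`relEntropySet_tensor_eq`), and each of the
three composite sets is of this kind; for `Smin` this uses the convexity of the local free states.

The second bound is additivity: `x log x` with `x = ∏ s i` splits into a sum even if some `s i` is
zero, so `tensor σ * log (tensor σ)` splits too (`tensor_mul_log_tensor_self`), and a state whose
support lies in that of `σ` factors through `σ`.

The first bound is the monotonicity of the relative entropy under partial trace, but for a product
state it follows from the operator Jensen inequality for the logarithm. In eigenbases of the
factors `ρ j`, `j ≠ i`, one has `tensor ρ = ∑ k, t k • W k (ρ i) (W k)ᴴ` and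
`marginal i σ = ∑ k, (W k)ᴴ σ (W k)` with isometries `W k` (`embed`) and a probability distribution
`t`, and the claim becomes `∑ k, t k ⟨W k u, log (σ / t k) W k u⟩ ≤ ⟨u, log (marginal i σ) u⟩`
(`jensen_log`). It is derived from the analogous inequality for the resolvents `(· + R)⁻¹`
(`resolvent_le`), which is a completion of squares, by integrating over `R`; as all the quadratic
forms are finite sums over eigenvalues, the integration is a monotonicity argument for a real
function (`sum_mul_log_nonpos`).
-/

namespace Composite

/-! ### Spectral decompositions and comparison of logarithmic sums -/

/-- `A = U diag(a) Uᴴ` with `U` unitary and `a` real: the columns of `U` are an orthonormal basis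
of eigenvectors of `A`, with eigenvalues `a`. -/
structure IsSpectral {n : Type*} [Fintype n] [DecidableEq n] (A U : Matrix n n ℂ) (a : n → ℝ) :
    Prop where
  left_inv : Uᴴ * U = 1
  right_inv : U * Uᴴ = 1
  eq : A = U * Matrix.diagonal (fun l => (a l : ℂ)) * Uᴴ

theorem star_col_dotProduct {n : Type*} [Fintype n] (U : Matrix n n ℂ) (k : n) (v : n → ℂ) :
    star (U.col k) ⬝ᵥ v = (Uᴴ *ᵥ v) k := by
  simp [Matrix.mulVec, dotProduct, Matrix.col]

section Spectral

variable {n : Type*} [Fintype n] [DecidableEq n] {A U : Matrix n n ℂ} {a : n → ℝ}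

theorem exists_isSpectral (hA : A.IsHermitian) : ∃ U a, IsSpectral A U a := by
  refine ⟨hA.eigenvectorUnitary, hA.eigenvalues, ?_, ?_, ?_⟩
  · exact Unitary.coe_star_mul_self hA.eigenvectorUnitary
  · exact Unitary.coe_mul_star_self hA.eigenvectorUnitary
  · exact hA.spectral_theorem

namespace IsSpectral

theorem isHermitian (h : IsSpectral A U a) : A.IsHermitian := by
  have hD : (Matrix.diagonal (fun l => (a l : ℂ))).IsHermitian := by
    rw [Matrix.isHermitian_diagonal_iff]
    intro l
    simp [IsSelfAdjoint]
  rw [h.eq]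
  exact Matrix.isHermitian_mul_mul_conjTranspose _ hD

/-- The functional calculus may be computed in any orthonormal eigenbasis. -/
theorem cfc (h : IsSpectral A U a) (f : ℝ → ℝ) : IsSpectral (cfc f A) U (fun l => f (a l)) := by
  refine ⟨h.left_inv, h.right_inv, ?_⟩
  have hA := h.isHermitian
  obtain ⟨V, e, hV1, hV2, hAV, hc⟩ : ∃ (V : Matrix n n ℂ) (e : n → ℝ), Vᴴ * V = 1 ∧ V * Vᴴ = 1 ∧
      A = V * Matrix.diagonal (fun l => (e l : ℂ)) * Vᴴ ∧
      _root_.cfc f A = V * Matrix.diagonal (fun l => (f (e l) : ℂ)) * Vᴴ := by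
    refine ⟨hA.eigenvectorUnitary, hA.eigenvalues, ?_, ?_, hA.spectral_theorem, ?_⟩
    · exact Unitary.coe_star_mul_self hA.eigenvectorUnitary
    · exact Unitary.coe_mul_star_self hA.eigenvectorUnitary
    · rw [hA.cfc_eq]; rfl
  -- The transition matrix `Vᴴ U` only connects equal eigenvalues, hence intertwines `f(e)`, `f(a)`.
  have hW : Matrix.diagonal (fun l => (e l : ℂ)) * (Vᴴ * U) =
      (Vᴴ * U) * Matrix.diagonal (fun l => (a l : ℂ)) := by
    have h1 : Vᴴ * A * U = Matrix.diagonal (fun l => (e l : ℂ)) * (Vᴴ * U) := by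
      rw [hAV]
      simp only [← mul_assoc, hV1, one_mul]
    rw [← h1, h.eq]
    simp only [mul_assoc, h.left_inv, mul_one]
  have hWf : Matrix.diagonal (fun l => (f (e l) : ℂ)) * (Vᴴ * U) =
      (Vᴴ * U) * Matrix.diagonal (fun l => (f (a l) : ℂ)) := by
    ext i j
    have hij := congrFun (congrFun hW i) j
    rw [Matrix.diagonal_mul, Matrix.mul_diagonal] at hij ⊢
    by_cases h0 : (Vᴴ * U) i j = 0
    · simp [h0]
    · have : (e i : ℂ) = a j := by
        rw [mul_comm] at hij
        exact mul_left_cancel₀ h0 hij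
      rw [Complex.ofReal_inj.mp this, mul_comm]
  calc _root_.cfc f A = V * (Matrix.diagonal (fun l => (f (e l) : ℂ)) * (Vᴴ * U)) * Uᴴ := by
        rw [hc]
        simp only [mul_assoc, h.right_inv, mul_one]
    _ = _ := by
        rw [hWf]
        simp only [← mul_assoc, hV2, one_mul]

theorem dotProduct_mulVec (h : IsSpectral A U a) (v w : n → ℂ) :
    star v ⬝ᵥ (A *ᵥ w) = ∑ l, (a l : ℂ) * (star ((Uᴴ *ᵥ v) l) * (Uᴴ *ᵥ w) l) := by
  have h1 : star v ᵥ* U = star (Uᴴ *ᵥ v) := by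
    rw [Matrix.star_mulVec, Matrix.conjTranspose_conjTranspose]
  rw [h.eq, ← Matrix.mulVec_mulVec, ← Matrix.mulVec_mulVec, Matrix.dotProduct_mulVec, h1]
  simp only [dotProduct, Matrix.mulVec_diagonal, Pi.star_apply]
  exact Finset.sum_congr rfl fun l _ => by ring

theorem dotProduct_mulVec_self (h : IsSpectral A U a) (v : n → ℂ) :
    star v ⬝ᵥ (A *ᵥ v) = ((∑ l, a l * ‖(Uᴴ *ᵥ v) l‖ ^ 2 : ℝ) : ℂ) := by
  rw [h.dotProduct_mulVec]
  push_cast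
  refine Finset.sum_congr rfl fun l _ => ?_
  rw [Complex.star_def, Complex.conj_mul']

theorem star_dotProduct (h : IsSpectral A U a) (v w : n → ℂ) :
    star v ⬝ᵥ w = ∑ l, star ((Uᴴ *ᵥ v) l) * (Uᴴ *ᵥ w) l := by
  have h1 : IsSpectral 1 U (fun _ => 1) :=
    ⟨h.left_inv, h.right_inv, by simp [h.right_inv]⟩
  simpa using h1.dotProduct_mulVec v w

theorem star_dotProduct_self (h : IsSpectral A U a) (v : n → ℂ) :
    star v ⬝ᵥ v = ((∑ l, ‖(Uᴴ *ᵥ v) l‖ ^ 2 : ℝ) : ℂ) := by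
  rw [h.star_dotProduct]
  push_cast
  refine Finset.sum_congr rfl fun l _ => ?_
  rw [Complex.star_def, Complex.conj_mul']

theorem star_col_dotProduct_col (h : IsSpectral A U a) (k : n) :
    star (U.col k) ⬝ᵥ U.col k = 1 := by
  have := congrFun (congrFun h.left_inv k) k
  simpa [Matrix.mul_apply, dotProduct] using this

theorem mulVec_col (h : IsSpectral A U a) (k : n) : A *ᵥ U.col k = (a k : ℂ) • U.col k := by
  have h1 : A * U = U * Matrix.diagonal (fun l => (a l : ℂ)) := by
    rw [h.eq, mul_assoc, h.left_inv, mul_one]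
  ext x
  have := congrFun (congrFun h1 x) k
  rw [Matrix.mul_diagonal] at this
  simpa [mul_comm, Matrix.mulVec, dotProduct, Matrix.mul_apply] using this

theorem trace_mul (h : IsSpectral A U a) (B : Matrix n n ℂ) :
    (A * B).trace = ∑ k, (a k : ℂ) * (star (U.col k) ⬝ᵥ (B *ᵥ U.col k)) := by
  rw [h.eq, mul_assoc, mul_assoc, Matrix.trace_mul_comm, mul_assoc, Matrix.trace]
  refine Finset.sum_congr rfl fun k _ => ?_
  rw [Matrix.diag_apply, Matrix.diagonal_mul]
  congr 1
  simp [Matrix.mul_apply, dotProduct, Matrix.mulVec, Finset.sum_mul, Finset.mul_sum, mul_assoc]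
  exact Finset.sum_comm

theorem trace (h : IsSpectral A U a) : A.trace = ((∑ k, a k : ℝ) : ℂ) := by
  have := h.trace_mul 1
  simpa [h.star_col_dotProduct_col] using this

theorem nonneg (h : IsSpectral A U a) (hA : A.PosSemidef) (k : n) : 0 ≤ a k := by
  have := hA.dotProduct_mulVec_nonneg (U.col k)
  rw [h.mulVec_col, dotProduct_smul, h.star_col_dotProduct_col, smul_eq_mul, mul_one] at this
  exact_mod_cast this

/-- A vector orthogonal to the kernel of `A` has no component along a null eigenvector. -/
theorem component_eq_zero (h : IsSpectral A U a) {v : n → ℂ}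
    (hv : ∀ z, A *ᵥ z = 0 → star z ⬝ᵥ v = 0) {l : n} (hl : a l = 0) : (Uᴴ *ᵥ v) l = 0 := by
  rw [← star_col_dotProduct]
  exact hv _ (by rw [h.mulVec_col, hl]; simp)

end IsSpectral

end Spectral

/-- If `∑ c i = 0` and `∑ c i / (y i + R) ≥ 0` for all `R > 0`, then `R ↦ ∑ c i log (y i + R)`
increases on `[0, ∞)` to its limit `0`, so its value at `R = 0` is nonpositive. This takes the
place of the integral representation of the logarithm. -/
theorem sum_mul_log_nonpos {I : Type*} [Fintype I] (c y : I → ℝ) (hc : ∑ i, c i = 0)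
    (hy : ∀ i, 0 < y i) (h : ∀ R : ℝ, 0 < R → 0 ≤ ∑ i, c i / (y i + R)) :
    ∑ i, c i * Real.log (y i) ≤ 0 := by
  set g : ℝ → ℝ := fun R => ∑ i, c i * Real.log (y i + R) with hg
  have hd : ∀ R : ℝ, 0 ≤ R → HasDerivAt g (∑ i, c i / (y i + R)) R := by
    intro R hR
    refine HasDerivAt.fun_sum fun i _ => ?_
    have h1 : HasDerivAt (fun R => y i + R) 1 R := (hasDerivAt_id R).const_add (y i)
    have h2 := (h1.log (by have := hy i; positivity)).const_mul (c i)
    simpa [div_eq_mul_inv] using h2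
  have hmono : MonotoneOn g (Set.Ici 0) := by
    refine monotoneOn_of_deriv_nonneg (convex_Ici 0)
      (fun R hR => (hd R hR).continuousAt.continuousWithinAt) ?_ ?_
    · intro R hR
      rw [interior_Ici] at hR
      exact (hd R (le_of_lt hR)).differentiableAt.differentiableWithinAt
    · intro R hR
      rw [interior_Ici] at hR
      rw [(hd R (le_of_lt hR)).deriv]
      exact h R hR
  have hlim : Filter.Tendsto g Filter.atTop (nhds 0) := by
    have h1 : Filter.Tendsto (fun R : ℝ => ∑ i, c i * Real.log (y i / R + 1)) Filter.atTop
        (nhds (∑ i, c i * Real.log (0 + 1))) := by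
      refine tendsto_finsetSum _ fun i _ => Filter.Tendsto.const_mul _ ?_
      refine Filter.Tendsto.log ?_ (by norm_num)
      exact (tendsto_const_nhds.div_atTop Filter.tendsto_id).add_const 1
    simp only [zero_add, Real.log_one, mul_zero, Finset.sum_const_zero] at h1
    refine h1.congr' ?_
    filter_upwards [Filter.eventually_gt_atTop 0] with R hR
    have h2 : ∀ i, Real.log (y i / R + 1) = Real.log (y i + R) - Real.log R := by
      intro i
      rw [← Real.log_div (by have := hy i; positivity) hR.ne']
      congr 1
      field_simp
    simp only [h2, mul_sub, Finset.sum_sub_distrib, ← Finset.sum_mul, hc, zero_mul, sub_zero, hg]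
  have h0 : g 0 ≤ 0 := by
    refine ge_of_tendsto hlim ?_
    filter_upwards [Filter.eventually_ge_atTop 0] with R hR
    exact hmono (by simp) hR hR
  simpa [hg] using h0

/-- Comparison of the resolvent sums of two finite measures on `[0, ∞)` without mass at `0` and of
equal total mass yields the reverse comparison of their logarithmic moments. -/
theorem sum_mul_log_le {I J : Type*} [Fintype I] [Fintype J] (α x : I → ℝ) (β y : J → ℝ)
    (hx : ∀ i, 0 ≤ x i) (hy : ∀ j, 0 ≤ y j) (hαx : ∀ i, x i = 0 → α i = 0)
    (hβy : ∀ j, y j = 0 → β j = 0) (hsum : ∑ j, β j = ∑ i, α i)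
    (h : ∀ R : ℝ, 0 < R → ∑ i, α i / (x i + R) ≤ ∑ j, β j / (y j + R)) :
    ∑ j, β j * Real.log (y j) ≤ ∑ i, α i * Real.log (x i) := by
  have key := sum_mul_log_nonpos (I := J ⊕ I) (Sum.elim β fun i => -α i)
    -- Positions of zero mass may be moved from `0` to `1`.
    (Sum.elim (fun j => if y j = 0 then 1 else y j) fun i => if x i = 0 then 1 else x i)
    (by simp [hsum]) ?_ ?_
  · simp only [Fintype.sum_sum_type, Sum.elim_inl, Sum.elim_inr, neg_mul,
      Finset.sum_neg_distrib] at key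
    have e1 : ∀ j, β j * Real.log (if y j = 0 then 1 else y j) = β j * Real.log (y j) := by
      intro j; split_ifs with hj <;> simp [hj]
    have e2 : ∀ i, α i * Real.log (if x i = 0 then 1 else x i) = α i * Real.log (x i) := by
      intro i; split_ifs with hi <;> simp [hi]
    simp only [e1, e2] at key
    linarith
  · rintro (j | i)
    · simp only [Sum.elim_inl]
      split_ifs with hj
      · exact one_pos
      · exact lt_of_le_of_ne (hy j) (Ne.symm hj)
    · simp only [Sum.elim_inr]
      split_ifs with hi
      · exact one_pos
      · exact lt_of_le_of_ne (hx i) (Ne.symm hi)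
  · intro R hR
    have := h R hR
    simp only [Fintype.sum_sum_type, Sum.elim_inl, Sum.elim_inr, neg_div, Finset.sum_neg_distrib]
    have e1 : ∀ j, β j / ((if y j = 0 then 1 else y j) + R) = β j / (y j + R) := by
      intro j; split_ifs with hj
      · simp [hβy j hj]
      · rfl
    have e2 : ∀ i, α i / ((if x i = 0 then 1 else x i) + R) = α i / (x i + R) := by
      intro i; split_ifs with hi
      · simp [hαx i hi]
      · rfl
    simp only [e1, e2]
    linarith

/-! ### Operator Jensen inequality for the logarithm -/

section Jensen

variable {n m κ : Type*} [Fintype n] [DecidableEq n] [Fintype m] [DecidableEq m] [Fintype κ]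
  {W : κ → Matrix m n ℂ} {t : κ → ℝ} {ρ X Ux : Matrix n n ℂ} {σ V : Matrix m m ℂ} {x : n → ℝ}
  {s : m → ℝ}

omit [DecidableEq n] [DecidableEq m] in
theorem star_mulVec_dotProduct_mulVec (A : Matrix m n ℂ) (B : Matrix m m ℂ) (v w : n → ℂ) :
    star (A *ᵥ v) ⬝ᵥ (B *ᵥ (A *ᵥ w)) = star v ⬝ᵥ ((Aᴴ * B * A) *ᵥ w) := by
  rw [Matrix.star_mulVec, ← Matrix.dotProduct_mulVec, Matrix.mulVec_mulVec, Matrix.mulVec_mulVec,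
    Matrix.mul_assoc]

theorem star_isometry_dotProduct {A : Matrix m n ℂ} (hA : Aᴴ * A = 1) (v w : n → ℂ) :
    star (A *ᵥ v) ⬝ᵥ (A *ᵥ w) = star v ⬝ᵥ w := by
  have := star_mulVec_dotProduct_mulVec A 1 v w
  simpa [hA] using this

/-- Completing the square: the scalar form of the variational formula
`⟨e, (s + R)⁻¹ e⟩ = sup_y (2 Re ⟨e, y⟩ - ⟨y, (s + R) y⟩)`, scaled by `t` and with `s` replaced by
`s / t`. It survives at `t = 0`, where the quotient takes the value `0`. -/
theorem two_mul_re_sub_le {t s R : ℝ} (ht : 0 ≤ t) (hs : 0 ≤ s) (hR : 0 < R) (e y : ℂ) :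
    2 * t * (star e * y).re - s * ‖y‖ ^ 2 - t * R * ‖y‖ ^ 2 ≤ t * ‖e‖ ^ 2 / (s / t + R) := by
  rcases ht.eq_or_lt with rfl | ht
  · have : 0 ≤ s * ‖y‖ ^ 2 := by positivity
    simp [this]
  · have hp : 0 < s / t + R := by positivity
    have h1 : (star e * y).re ≤ ‖e‖ * ‖y‖ := by
      refine (Complex.re_le_norm _).trans ?_
      simp
    have h2 : 2 * (‖e‖ * ‖y‖) - (s / t + R) * ‖y‖ ^ 2 ≤ ‖e‖ ^ 2 / (s / t + R) := by
      rw [le_div_iff₀ hp]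
      nlinarith [sq_nonneg (‖e‖ - (s / t + R) * ‖y‖)]
    have h3 : s * ‖y‖ ^ 2 = t * ((s / t) * ‖y‖ ^ 2) := by
      field_simp
    calc 2 * t * (star e * y).re - s * ‖y‖ ^ 2 - t * R * ‖y‖ ^ 2
        ≤ t * (2 * (‖e‖ * ‖y‖) - (s / t + R) * ‖y‖ ^ 2) := by
          rw [h3]
          nlinarith [mul_le_mul_of_nonneg_left h1 ht.le]
      _ ≤ t * (‖e‖ ^ 2 / (s / t + R)) := mul_le_mul_of_nonneg_left h2 ht.le
      _ = _ := by rw [mul_div_assoc]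

/-- Convexity of the resolvent, in the form
`⟨u, (X + R)⁻¹ u⟩ ≤ ∑ k, t k ⟨W k u, (σ / t k + R)⁻¹ W k u⟩` for `X = ∑ k, (W k)ᴴ σ (W k)`. -/
theorem resolvent_le (hW : ∀ k, (W k)ᴴ * W k = 1) (ht : ∀ k, 0 ≤ t k) (hsum : ∑ k, t k = 1)
    (hXσ : X = ∑ k, (W k)ᴴ * σ * W k) (hX : IsSpectral X Ux x) (hx : ∀ l, 0 ≤ x l)
    (hσ : IsSpectral σ V s) (hs : ∀ l, 0 ≤ s l) {R : ℝ} (hR : 0 < R) (u : n → ℂ) :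
    ∑ l, ‖(Uxᴴ *ᵥ u) l‖ ^ 2 / (x l + R) ≤
      ∑ k, ∑ l, t k * ‖(Vᴴ *ᵥ (W k *ᵥ u)) l‖ ^ 2 / (s l / t k + R) := by
  -- The optimal test vector is `w = (X + R)⁻¹ u`, transported by each `W k`.
  set w : n → ℂ := Ux *ᵥ (fun l => (Uxᴴ *ᵥ u) l / ((x l + R : ℝ) : ℂ)) with hw
  have hwl : ∀ l, (Uxᴴ *ᵥ w) l = (Uxᴴ *ᵥ u) l / ((x l + R : ℝ) : ℂ) := by
    intro l
    rw [hw, Matrix.mulVec_mulVec, hX.left_inv, Matrix.one_mulVec]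
  have hk : ∀ k, 2 * t k * (star u ⬝ᵥ w).re - (star w ⬝ᵥ (((W k)ᴴ * σ * W k) *ᵥ w)).re -
      t k * R * (star w ⬝ᵥ w).re ≤
        ∑ l, t k * ‖(Vᴴ *ᵥ (W k *ᵥ u)) l‖ ^ 2 / (s l / t k + R) := by
    intro k
    rw [← star_isometry_dotProduct (hW k) u w, ← star_isometry_dotProduct (hW k) w w,
      ← star_mulVec_dotProduct_mulVec, hσ.dotProduct_mulVec_self, hσ.star_dotProduct_self,
      hσ.star_dotProduct, Complex.ofReal_re, Complex.ofReal_re, Complex.re_sum, Finset.mul_sum,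
      Finset.mul_sum, ← Finset.sum_sub_distrib, ← Finset.sum_sub_distrib]
    exact Finset.sum_le_sum fun l _ => two_mul_re_sub_le (ht k) (hs l) hR _ _
  have hall := Finset.sum_le_sum fun k (_ : k ∈ Finset.univ) => hk k
  refine le_trans (le_of_eq ?_) hall
  have hq : ∑ k, (star w ⬝ᵥ (((W k)ᴴ * σ * W k) *ᵥ w)).re = (star w ⬝ᵥ (X *ᵥ w)).re := by
    rw [hXσ, Matrix.sum_mulVec, dotProduct_sum, Complex.re_sum]
  rw [Finset.sum_sub_distrib, Finset.sum_sub_distrib, hq, ← Finset.sum_mul, ← Finset.sum_mul,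
    ← Finset.sum_mul, ← Finset.mul_sum, hsum, hX.dotProduct_mulVec_self, hX.star_dotProduct_self,
    hX.star_dotProduct, Complex.ofReal_re, Complex.ofReal_re, Complex.re_sum, Finset.mul_sum,
    Finset.mul_sum, ← Finset.sum_sub_distrib, ← Finset.sum_sub_distrib]
  refine Finset.sum_congr rfl fun l _ => ?_
  have hp : 0 < x l + R := by have := hx l; positivity
  have e1 : (star ((Uxᴴ *ᵥ u) l) * (Uxᴴ *ᵥ w) l).re = ‖(Uxᴴ *ᵥ u) l‖ ^ 2 / (x l + R) := by
    rw [hwl, mul_div_assoc', Complex.star_def, Complex.conj_mul', ← Complex.ofReal_pow,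
      ← Complex.ofReal_div, Complex.ofReal_re]
  have e2 : ‖(Uxᴴ *ᵥ w) l‖ = ‖(Uxᴴ *ᵥ u) l‖ / (x l + R) := by
    rw [hwl, norm_div, Complex.norm_real, Real.norm_of_nonneg hp.le]
  rw [e1, e2]
  field_simp
  ring

/-- Operator Jensen inequality for the logarithm:
`∑ k, t k ⟨W k u, log (σ / t k) W k u⟩ ≤ ⟨u, log X u⟩` for `X = ∑ k, (W k)ᴴ σ (W k)`, where the
vectors are orthogonal to the kernels on which the logarithm is singular. -/
theorem jensen_log (hW : ∀ k, (W k)ᴴ * W k = 1) (ht : ∀ k, 0 ≤ t k) (hsum : ∑ k, t k = 1)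
    (hXσ : X = ∑ k, (W k)ᴴ * σ * W k) (hXp : X.PosSemidef) (hσp : σ.PosSemidef) {u : n → ℂ}
    (hu : ∀ z, X *ᵥ z = 0 → star z ⬝ᵥ u = 0)
    (huW : ∀ k, t k ≠ 0 → ∀ z, σ *ᵥ z = 0 → star z ⬝ᵥ (W k *ᵥ u) = 0) :
    ∑ k, t k * (star (W k *ᵥ u) ⬝ᵥ (cfc (Real.logb 2) σ *ᵥ (W k *ᵥ u))).re ≤
      (star u ⬝ᵥ (cfc (Real.logb 2) X *ᵥ u)).re +
        (star u ⬝ᵥ u).re * ∑ k, t k * Real.logb 2 (t k) := by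
  obtain ⟨Ux, x, hX⟩ := exists_isSpectral hXp.1
  obtain ⟨V, s, hσ⟩ := exists_isSpectral hσp.1
  have hx := hX.nonneg hXp
  have hs := hσ.nonneg hσp
  have hcomp : ∀ k l, t k ≠ 0 → s l = 0 → (Vᴴ *ᵥ (W k *ᵥ u)) l = 0 := fun k l hk hl =>
    hσ.component_eq_zero (huW k hk) hl
  have hnorm : ∀ k, ∑ l, ‖(Vᴴ *ᵥ (W k *ᵥ u)) l‖ ^ 2 = (star u ⬝ᵥ u).re := by
    intro k
    rw [← star_isometry_dotProduct (hW k), hσ.star_dotProduct_self, Complex.ofReal_re]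
  have key := sum_mul_log_le (fun l => ‖(Uxᴴ *ᵥ u) l‖ ^ 2) x
    (fun p : κ × m => t p.1 * ‖(Vᴴ *ᵥ (W p.1 *ᵥ u)) p.2‖ ^ 2) (fun p => s p.2 / t p.1) hx
    (fun p => div_nonneg (hs _) (ht _)) (fun l hl => by simp [hX.component_eq_zero hu hl])
    (fun p hp => ?_) ?_ (fun R hR => ?_)
  · have hlog : ∀ p : κ × m, t p.1 * ‖(Vᴴ *ᵥ (W p.1 *ᵥ u)) p.2‖ ^ 2 * Real.log (s p.2 / t p.1) =
        t p.1 * (Real.log (s p.2) * ‖(Vᴴ *ᵥ (W p.1 *ᵥ u)) p.2‖ ^ 2) -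
          t p.1 * Real.log (t p.1) * ‖(Vᴴ *ᵥ (W p.1 *ᵥ u)) p.2‖ ^ 2 := by
      rintro ⟨k, l⟩
      by_cases hk : t k = 0
      · simp [hk]
      · by_cases hl : s l = 0
        · simp [hcomp k l hk hl]
        · simp only
          rw [Real.log_div hl hk]
          ring
    simp only [hlog, Fintype.sum_prod_type, Finset.sum_sub_distrib, ← Finset.mul_sum, hnorm] at key
    rw [← Finset.sum_mul] at key
    rw [(hX.cfc _).dotProduct_mulVec_self, Complex.ofReal_re]
    simp only [(hσ.cfc _).dotProduct_mulVec_self, Complex.ofReal_re, Real.logb]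
    have h2 : 0 < Real.log 2 := Real.log_pos one_lt_two
    simp only [div_mul_eq_mul_div, mul_div_assoc', ← Finset.sum_div]
    rw [← add_div, div_le_div_iff_of_pos_right h2]
    have e1 : ∑ l, Real.log (x l) * ‖(Uxᴴ *ᵥ u) l‖ ^ 2 =
        ∑ l, ‖(Uxᴴ *ᵥ u) l‖ ^ 2 * Real.log (x l) := Finset.sum_congr rfl fun l _ => mul_comm _ _
    rw [e1]
    linarith
  · rcases div_eq_zero_iff.mp hp with h | h
    · by_cases hk : t p.1 = 0
      · simp [hk]
      · simp [hcomp _ _ hk h]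
    · simp [h]
  · simp only [Fintype.sum_prod_type, ← Finset.mul_sum, hnorm]
    rw [← Finset.sum_mul, hsum, one_mul, ← Complex.ofReal_re (∑ l, _), ← hX.star_dotProduct_self]
  · have := resolvent_le hW ht hsum hXσ hX hx hσ hs hR u
    simpa [Fintype.sum_prod_type] using this

/-- The special case of the data-processing inequality in which the state
`∑ k, t k • W k ρ (W k)ᴴ` is spread isometrically with weights `t`, while the second argument `σ`
is arbitrary. -/
theorem ker_le_and_trace_mul_log_le (hW : ∀ k, (W k)ᴴ * W k = 1) (ht : ∀ k, 0 ≤ t k)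
    (hsum : ∑ k, t k = 1) (hρ : ρ.PosSemidef) (hσp : σ.PosSemidef) {P : Matrix m m ℂ}
    (hP : P = ∑ k, (t k : ℂ) • (W k * ρ * (W k)ᴴ)) (hXσ : X = ∑ k, (W k)ᴴ * σ * W k)
    (hker : ∀ v, σ *ᵥ v = 0 → P *ᵥ v = 0) :
    (∀ v, X *ᵥ v = 0 → ρ *ᵥ v = 0) ∧
      (P * cfc (Real.logb 2) σ).trace.re ≤
        (ρ * cfc (Real.logb 2) X).trace.re + ρ.trace.re * ∑ k, t k * Real.logb 2 (t k) := by
  obtain ⟨U, r, hU⟩ := exists_isSpectral hρ.1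
  have hr := hU.nonneg hρ
  have hXp : X.PosSemidef := by
    rw [hXσ]
    exact Matrix.posSemidef_sum _ fun k _ => hσp.conjTranspose_mul_mul_same (W k)
  -- Every `W k` pulls a null vector of `σ` back to a null vector of `ρ`.
  have hpull : ∀ z, σ *ᵥ z = 0 → ∀ k, t k ≠ 0 → ρ *ᵥ ((W k)ᴴ *ᵥ z) = 0 := by
    intro z hz k hk
    have hq : ∀ k, star z ⬝ᵥ ((W k * ρ * (W k)ᴴ) *ᵥ z) =
        star ((W k)ᴴ *ᵥ z) ⬝ᵥ (ρ *ᵥ ((W k)ᴴ *ᵥ z)) := by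
      intro k
      rw [star_mulVec_dotProduct_mulVec, Matrix.conjTranspose_conjTranspose]
    have h0 : ∑ k, (t k : ℂ) * (star ((W k)ᴴ *ᵥ z) ⬝ᵥ (ρ *ᵥ ((W k)ᴴ *ᵥ z))) = 0 := by
      have h1 : star z ⬝ᵥ (P *ᵥ z) = 0 := by rw [hker z hz, dotProduct_zero]
      rw [hP, Matrix.sum_mulVec, dotProduct_sum] at h1
      simpa only [Matrix.smul_mulVec, dotProduct_smul, smul_eq_mul, hq] using h1
    rw [Finset.sum_eq_zero_iff_of_nonneg] at h0
    · have h2 := (mul_eq_zero.mp (h0 k (Finset.mem_univ k))).resolve_left (by exact_mod_cast hk)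
      exact (hρ.dotProduct_mulVec_zero_iff _).mp h2
    · intro k _
      exact mul_nonneg (by exact_mod_cast ht k) (hρ.dotProduct_mulVec_nonneg _)
  have hkerX : ∀ v, X *ᵥ v = 0 → ρ *ᵥ v = 0 := by
    intro v hv
    have h0 : ∑ k, star (W k *ᵥ v) ⬝ᵥ (σ *ᵥ (W k *ᵥ v)) = 0 := by
      simp only [star_mulVec_dotProduct_mulVec]
      rw [← dotProduct_sum, ← Matrix.sum_mulVec, ← hXσ, hv, dotProduct_zero]
    rw [Finset.sum_eq_zero_iff_of_nonneg fun k _ => hσp.dotProduct_mulVec_nonneg _] at h0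
    obtain ⟨k, hk⟩ : ∃ k, t k ≠ 0 := by
      by_contra! h
      simp [h] at hsum
    have := hpull _ ((hσp.dotProduct_mulVec_zero_iff _).mp (h0 k (Finset.mem_univ k))) k hk
    rwa [Matrix.mulVec_mulVec (v := v), hW, Matrix.one_mulVec] at this
  refine ⟨hkerX, ?_⟩
  -- Eigenvectors of `ρ` with nonzero eigenvalue are orthogonal to the kernel of `ρ`.
  have horth : ∀ a, r a ≠ 0 → ∀ z, ρ *ᵥ z = 0 → star z ⬝ᵥ U.col a = 0 := by
    intro a ha z hz
    have h1 : star z ⬝ᵥ (ρ *ᵥ U.col a) = 0 := by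
      rw [Matrix.dotProduct_mulVec, ← hρ.1.eq, ← Matrix.star_mulVec, hz]
      simp
    rw [hU.mulVec_col, dotProduct_smul, smul_eq_mul] at h1
    exact (mul_eq_zero.mp h1).resolve_left (by exact_mod_cast ha)
  have hvec : ∀ a, r a * ∑ k, t k *
      (star (W k *ᵥ U.col a) ⬝ᵥ (cfc (Real.logb 2) σ *ᵥ (W k *ᵥ U.col a))).re ≤
      r a * ((star (U.col a) ⬝ᵥ (cfc (Real.logb 2) X *ᵥ U.col a)).re +
        ∑ k, t k * Real.logb 2 (t k)) := by
    intro a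
    by_cases ha : r a = 0
    · simp [ha]
    · refine mul_le_mul_of_nonneg_left ?_ (hr a)
      have := jensen_log hW ht hsum hXσ hXp hσp (u := U.col a)
        (fun z hz => horth a ha z (hkerX z hz)) (fun k hk z hz => ?_)
      · simpa [hU.star_col_dotProduct_col] using this
      · have h1 := horth a ha _ (hpull z hz k hk)
        rwa [Matrix.star_mulVec, Matrix.conjTranspose_conjTranspose,
          ← Matrix.dotProduct_mulVec] at h1
  have hL : (P * cfc (Real.logb 2) σ).trace.re = ∑ a, r a * ∑ k, t k *
      (star (W k *ᵥ U.col a) ⬝ᵥ (cfc (Real.logb 2) σ *ᵥ (W k *ᵥ U.col a))).re := by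
    have h1 : ∀ k, (W k * ρ * (W k)ᴴ * cfc (Real.logb 2) σ).trace =
        (ρ * ((W k)ᴴ * cfc (Real.logb 2) σ * W k)).trace := by
      intro k
      rw [Matrix.mul_assoc, Matrix.mul_assoc, Matrix.trace_mul_comm]
      simp only [Matrix.mul_assoc]
    rw [hP, Finset.sum_mul, Matrix.trace_sum]
    simp only [Matrix.smul_mul, Matrix.trace_smul, h1, hU.trace_mul,
      ← star_mulVec_dotProduct_mulVec, smul_eq_mul, Complex.re_sum, Complex.re_ofReal_mul,
      Finset.mul_sum]
    rw [Finset.sum_comm]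
    exact Finset.sum_congr rfl fun a _ => Finset.sum_congr rfl fun k _ => by ring
  have hR : (ρ * cfc (Real.logb 2) X).trace.re + ρ.trace.re * ∑ k, t k * Real.logb 2 (t k) =
      ∑ a, r a * ((star (U.col a) ⬝ᵥ (cfc (Real.logb 2) X *ᵥ U.col a)).re +
        ∑ k, t k * Real.logb 2 (t k)) := by
    simp only [mul_add, Finset.sum_add_distrib]
    rw [hU.trace_mul, hU.trace, Complex.re_sum, Complex.ofReal_re, Finset.sum_mul]
    simp only [Complex.re_ofReal_mul]
  rw [hL, hR]
  exact Finset.sum_le_sum fun a _ => hvec a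

end Jensen

/-! ### Tensor products and additivity of the logarithm -/

section Tensor

variable {ι : Type*} [Fintype ι] {d : ι → Type*}

theorem tensor_conjTranspose (A : ∀ i, Matrix (d i) (d i) ℂ) :
    (tensor A)ᴴ = tensor fun i => (A i)ᴴ := by
  ext x y
  simp [tensor]

variable [DecidableEq ι] [∀ i, Fintype (d i)]

theorem tensor_mul (A B : ∀ i, Matrix (d i) (d i) ℂ) :
    tensor A * tensor B = tensor fun i => A i * B i := by
  ext x y
  simp only [tensor, Matrix.mul_apply, Matrix.of_apply, Fintype.prod_sum, Finset.prod_mul_distrib]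

theorem trace_tensor (A : ∀ i, Matrix (d i) (d i) ℂ) : (tensor A).trace = ∏ i, (A i).trace := by
  simp only [tensor, Matrix.trace, Matrix.diag_apply, Matrix.of_apply, Fintype.prod_sum]

variable [∀ i, DecidableEq (d i)]

omit [DecidableEq ι] [∀ i, Fintype (d i)] in
theorem tensor_diagonal [DecidableEq (∀ i, d i)] (a : ∀ i, d i → ℂ) :
    tensor (fun i => Matrix.diagonal (a i)) =
      Matrix.diagonal fun x : ∀ i, d i => ∏ i, a i (x i) := by
  ext x y
  by_cases hxy : x = y
  · subst hxy
    simp [tensor]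
  · rw [Matrix.diagonal_apply_ne _ hxy]
    obtain ⟨i, hi⟩ := Function.ne_iff.mp hxy
    exact Finset.prod_eq_zero (Finset.mem_univ i) (Matrix.diagonal_apply_ne _ hi)

omit [DecidableEq ι] [∀ i, Fintype (d i)] in
theorem tensor_one [DecidableEq (∀ i, d i)] :
    tensor (fun i => (1 : Matrix (d i) (d i) ℂ)) = 1 := by
  have := tensor_diagonal (d := d) fun i _ => (1 : ℂ)
  simpa using this

theorem IsSpectral.tensor {A U : ∀ i, Matrix (d i) (d i) ℂ} {a : ∀ i, d i → ℝ}
    (h : ∀ i, IsSpectral (A i) (U i) (a i)) :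
    IsSpectral (tensor A) (tensor U) fun x => ∏ i, a i (x i) := by
  refine ⟨?_, ?_, ?_⟩
  · rw [tensor_conjTranspose, tensor_mul]
    simp only [(h _).left_inv, tensor_one]
  · rw [tensor_conjTranspose, tensor_mul]
    simp only [(h _).right_inv, tensor_one]
  · have h1 := tensor_diagonal (d := d) fun i l => (a i l : ℂ)
    simp only [Complex.ofReal_prod]
    rw [← h1, tensor_conjTranspose, tensor_mul, tensor_mul]
    congr 1
    funext i
    exact (h i).eq

end Tensor

/-- The logarithm turns products into sums. With the factor `∏ i, s i` in front, the identity holds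
also if some `s i` vanishes. -/
theorem prod_mul_logb_prod {ι : Type*} [Fintype ι] [DecidableEq ι] (s : ι → ℝ) :
    (∏ i, s i) * Real.logb 2 (∏ i, s i) =
      ∑ j, ∏ i, if i = j then s i * Real.logb 2 (s i) else s i := by
  have h1 : ∀ j, (∏ i, if i = j then s i * Real.logb 2 (s i) else s i) =
      (∏ i, s i) * Real.logb 2 (s j) := by
    intro j
    rw [Fintype.prod_eq_mul_prod_subtype_ne _ j, Fintype.prod_eq_mul_prod_subtype_ne s j]
    have : ∀ i : {i // i ≠ j}, (if (i : ι) = j then s i * Real.logb 2 (s i) else s i) = s i :=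
      fun i => if_neg i.2
    simp only [this, if_true]
    ring
  simp only [h1, ← Finset.mul_sum]
  by_cases h : ∀ i ∈ Finset.univ, s i ≠ 0
  · rw [Real.logb_prod _ _ h]
  · push Not at h
    obtain ⟨i, hi, h0⟩ := h
    simp [Finset.prod_eq_zero hi h0]

/-- The Shannon entropy is additive on product distributions. -/
theorem sum_prod_mul_logb_prod {ι : Type*} [Fintype ι] [DecidableEq ι] {d : ι → Type*}
    [∀ i, Fintype (d i)] (r : ∀ i, d i → ℝ) (hr : ∀ i, ∑ k, r i k = 1) :
    ∑ k : ∀ i, d i, (∏ i, r i (k i)) * Real.logb 2 (∏ i, r i (k i)) =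
      ∑ i, ∑ l, r i l * Real.logb 2 (r i l) := by
  simp only [prod_mul_logb_prod]
  rw [Finset.sum_comm]
  refine Finset.sum_congr rfl fun j _ => ?_
  rw [← Fintype.prod_sum (fun i l => if i = j then r i l * Real.logb 2 (r i l) else r i l),
    Fintype.prod_eq_mul_prod_subtype_ne _ j]
  have : ∀ i : {i // i ≠ j},
      (∑ l, if (i : ι) = j then r i l * Real.logb 2 (r i l) else r i l) = 1 := by
    intro i
    simp only [if_neg i.2, hr]
  simp [this]

/-- `ker σ ⊆ ker ρ` means that `ρ` factors through `σ`. -/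
theorem exists_eq_mul_of_ker_le {n : Type*} [Fintype n] [DecidableEq n] {ρ σ : Matrix n n ℂ}
    (hσ : σ.IsHermitian) (h : ∀ v, σ *ᵥ v = 0 → ρ *ᵥ v = 0) : ∃ C, ρ = C * σ := by
  obtain ⟨V, s, hV⟩ := exists_isSpectral hσ
  -- The second factor is the pseudo-inverse of `σ`.
  refine ⟨ρ * (V * Matrix.diagonal (fun l => ((s l : ℂ))⁻¹) * Vᴴ), ?_⟩
  have h1 : ρ * V * Matrix.diagonal (fun l => ((s l : ℂ))⁻¹ * (s l : ℂ)) = ρ * V := by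
    ext x l
    rw [Matrix.mul_diagonal]
    by_cases hl : s l = 0
    · have h2 : ρ *ᵥ V.col l = 0 := h _ (by rw [hV.mulVec_col, hl]; simp)
      have h3 : (ρ * V) x l = 0 := congrFun h2 x
      rw [h3, zero_mul]
    · rw [inv_mul_cancel₀ (by exact_mod_cast hl), mul_one]
  calc ρ = ρ * V * Vᴴ := by rw [mul_assoc, hV.right_inv, mul_one]
    _ = ρ * V * (Matrix.diagonal (fun l => ((s l : ℂ))⁻¹) * Matrix.diagonal fun l => (s l : ℂ)) *
          Vᴴ := by rw [Matrix.diagonal_mul_diagonal, h1]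
    _ = ρ * (V * Matrix.diagonal (fun l => ((s l : ℂ))⁻¹) * Vᴴ) *
          (V * Matrix.diagonal (fun l => (s l : ℂ)) * Vᴴ) := by
        have : Vᴴ * (V * (Matrix.diagonal (fun l => (s l : ℂ)) * Vᴴ)) =
            Matrix.diagonal (fun l => (s l : ℂ)) * Vᴴ := by
          rw [← mul_assoc, hV.left_inv, one_mul]
        simp only [mul_assoc, this]
    _ = _ := by rw [← hV.eq]

section Additivity

variable {ι : Type*} [Fintype ι] [DecidableEq ι] {d : ι → Type*} [∀ i, Fintype (d i)]
  [∀ i, DecidableEq (d i)] {ρ σ : ∀ i, Matrix (d i) (d i) ℂ}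

theorem tensor_mul_log_tensor_self (hσ : ∀ i, (σ i).IsHermitian) :
    tensor σ * cfc (Real.logb 2) (tensor σ) =
      ∑ j, tensor fun i => if i = j then σ i * cfc (Real.logb 2) (σ i) else σ i := by
  choose V s hV using fun i => exists_isSpectral (hσ i)
  have hT := IsSpectral.tensor hV
  have h1 : ∀ j, tensor (fun i => if i = j then σ i * cfc (Real.logb 2) (σ i) else σ i) =
      tensor V * Matrix.diagonal (fun x : ∀ i, d i =>
        ((∏ i, if i = j then s i (x i) * Real.logb 2 (s i (x i)) else s i (x i) : ℝ) : ℂ)) *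
          (tensor V)ᴴ := by
    intro j
    refine (IsSpectral.tensor (U := V)
      (a := fun i l => if i = j then s i l * Real.logb 2 (s i l) else s i l) fun i => ?_).eq
    by_cases hi : i = j
    · simp only [if_pos hi]
      refine ⟨(hV i).left_inv, (hV i).right_inv, ?_⟩
      conv_lhs => rw [((hV i).cfc _).eq]
      conv_lhs => enter [1]; rw [(hV i).eq]
      have h2 : (V i)ᴴ * (V i * (Matrix.diagonal (fun l => ((Real.logb 2 (s i l) : ℝ) : ℂ)) *
          (V i)ᴴ)) = Matrix.diagonal (fun l => ((Real.logb 2 (s i l) : ℝ) : ℂ)) * (V i)ᴴ := by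
        rw [← mul_assoc, (hV i).left_inv, one_mul]
      simp only [mul_assoc, h2]
      rw [← mul_assoc (Matrix.diagonal _) (Matrix.diagonal _), Matrix.diagonal_mul_diagonal]
      simp only [Complex.ofReal_mul]
    · simp only [if_neg hi]
      exact hV i
  simp only [h1]
  rw [← Finset.sum_mul, ← Finset.mul_sum]
  have h3 : ∑ j, Matrix.diagonal (fun x : ∀ i, d i =>
      ((∏ i, if i = j then s i (x i) * Real.logb 2 (s i (x i)) else s i (x i) : ℝ) : ℂ)) =
      Matrix.diagonal (fun x : ∀ i, d i => ((∏ i, s i (x i) : ℝ) : ℂ)) *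
        Matrix.diagonal fun x : ∀ i, d i => ((Real.logb 2 (∏ i, s i (x i)) : ℝ) : ℂ) := by
    rw [Matrix.diagonal_mul_diagonal]
    refine (map_sum (Matrix.diagonalAddMonoidHom _ ℂ) _ _).symm.trans ?_
    rw [Matrix.diagonalAddMonoidHom_apply]
    congr 1
    funext x
    rw [Finset.sum_apply, ← Complex.ofReal_sum, ← prod_mul_logb_prod, Complex.ofReal_mul]
  rw [h3]
  conv_lhs => rw [(hT.cfc _).eq]
  conv_lhs => enter [1]; rw [hT.eq]
  have h2 : (tensor V)ᴴ * (tensor V *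
      (Matrix.diagonal (fun x : ∀ i, d i => ((Real.logb 2 (∏ i, s i (x i)) : ℝ) : ℂ)) *
        (tensor V)ᴴ)) =
      Matrix.diagonal (fun x : ∀ i, d i => ((Real.logb 2 (∏ i, s i (x i)) : ℝ) : ℂ)) *
        (tensor V)ᴴ := by
    rw [← mul_assoc, hT.left_inv, one_mul]
  simp only [mul_assoc, h2]

/-- `log` of a tensor product is the sum of the local logarithms, as seen by a product state whose
support is contained in that of `tensor σ`. -/
theorem trace_tensor_mul_log_tensor (hρ : ∀ i, (ρ i).trace = 1) (hσ : ∀ i, (σ i).IsHermitian)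
    (hker : ∀ i v, σ i *ᵥ v = 0 → ρ i *ᵥ v = 0) :
    (tensor ρ * cfc (Real.logb 2) (tensor σ)).trace =
      ∑ j, (ρ j * cfc (Real.logb 2) (σ j)).trace := by
  choose C hC using fun i => exists_eq_mul_of_ker_le (hσ i) (hker i)
  have h1 : tensor ρ = tensor C * tensor σ := by
    rw [tensor_mul]
    congr 1
    funext i
    exact hC i
  rw [h1, mul_assoc, tensor_mul_log_tensor_self hσ, Finset.mul_sum, Matrix.trace_sum]
  refine Finset.sum_congr rfl fun j _ => ?_
  rw [tensor_mul, trace_tensor, Fintype.prod_eq_mul_prod_subtype_ne _ j]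
  have h2 : ∀ i : {i // i ≠ j},
      (C i * if (i : ι) = j then σ i * cfc (Real.logb 2) (σ i) else σ i).trace = 1 := by
    intro i
    rw [if_neg i.2, ← hC, hρ]
  simp only [h2, if_true, Finset.prod_const_one, mul_one]
  rw [← mul_assoc, ← hC]

theorem tensor_ker_le (hσ : ∀ i, (σ i).IsHermitian)
    (hker : ∀ i v, σ i *ᵥ v = 0 → ρ i *ᵥ v = 0) (v : (∀ i, d i) → ℂ)
    (hv : tensor σ *ᵥ v = 0) : tensor ρ *ᵥ v = 0 := by
  choose C hC using fun i => exists_eq_mul_of_ker_le (hσ i) (hker i)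
  have h1 : tensor ρ = tensor C * tensor σ := by
    rw [tensor_mul]
    congr 1
    funext i
    exact hC i
  rw [h1, ← Matrix.mulVec_mulVec, hv, Matrix.mulVec_zero]

end Additivity

/-! ### Partial trace in product bases and the relative entropy -/

section Embedding

variable {ι : Type*} [Fintype ι] [DecidableEq ι] {d : ι → Type*} [∀ i, DecidableEq (d i)]

/-- The matrix of `v ↦ v ⊗ ⨂ j ≠ i, U j (·) (k j)`, which places `v` at party `i` and the
`k j`-th column of `U j` at every other party `j`. -/
def embed (i : ι) (U : ∀ j, Matrix (d j) (d j) ℂ) (k : ∀ j : {j // j ≠ i}, d j) :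
    Matrix (∀ j, d j) (d i) ℂ :=
  Matrix.of fun x α => if x i = α then ∏ j : {j // j ≠ i}, U j (x j) (k j) else 0

variable [∀ i, Fintype (d i)]

omit [∀ i, DecidableEq (d i)] in
theorem sum_pi_split (i : ι) (F : d i → (∀ j : {j // j ≠ i}, d j) → ℂ) :
    ∑ x : ∀ j, d j, F (x i) (fun j => x j) = ∑ a, ∑ y, F a y := by
  rw [← Fintype.sum_prod_type']
  exact Fintype.sum_equiv (Equiv.piSplitAt i d) _ _ fun x => rfl

theorem embed_isometry (i : ι) {U : ∀ j, Matrix (d j) (d j) ℂ} (hU : ∀ j, (U j)ᴴ * U j = 1)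
    (k : ∀ j : {j // j ≠ i}, d j) : (embed i U k)ᴴ * embed i U k = 1 := by
  ext α β
  have h1 := sum_pi_split i fun a (y : ∀ j : {j // j ≠ i}, d j) =>
    star (if a = α then ∏ j : {j // j ≠ i}, U j (y j) (k j) else 0) *
      (if a = β then ∏ j : {j // j ≠ i}, U j (y j) (k j) else 0)
  have h2 : ∑ y : ∀ j : {j // j ≠ i}, d j, star (∏ j : {j // j ≠ i}, U j (y j) (k j)) *
      ∏ j : {j // j ≠ i}, U j (y j) (k j) = 1 := by
    simp only [star_prod, ← Finset.prod_mul_distrib]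
    rw [← Fintype.prod_sum (fun (j : {j // j ≠ i}) l => star (U j l (k j)) * U j l (k j))]
    refine Finset.prod_eq_one fun j _ => ?_
    have := congrFun (congrFun (hU j) (k j)) (k j)
    simpa [Matrix.mul_apply] using this
  rw [Matrix.mul_apply]
  refine h1.trans ?_
  rw [Finset.sum_eq_single α]
  · by_cases h : α = β
    · subst h
      simpa using h2
    · simp [h]
  · intro b _ hb
    simp [hb]
  · simp

theorem tensor_eq_sum_embed (i : ι) {ρ U : ∀ j, Matrix (d j) (d j) ℂ} {r : ∀ j, d j → ℝ}
    (h : ∀ j, IsSpectral (ρ j) (U j) (r j)) :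
    tensor ρ = ∑ k : ∀ j : {j // j ≠ i}, d j,
      ((∏ j : {j // j ≠ i}, r j (k j) : ℝ) : ℂ) • (embed i U k * ρ i * (embed i U k)ᴴ) := by
  ext x y
  have h1 : ∀ j, ρ j (x j) (y j) = ∑ l, (r j l : ℂ) * (U j (x j) l * star (U j (y j) l)) := by
    intro j
    conv_lhs => rw [(h j).eq]
    rw [Matrix.mul_apply]
    refine Finset.sum_congr rfl fun l _ => ?_
    rw [Matrix.mul_diagonal, Matrix.conjTranspose_apply]
    ring
  have h2 : ∀ k : ∀ j : {j // j ≠ i}, d j, (embed i U k * ρ i * (embed i U k)ᴴ) x y =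
      ρ i (x i) (y i) *
        ∏ j : {j // j ≠ i}, U j (x j) (k j) * star (U j (y j) (k j)) := by
    intro k
    simp only [Matrix.mul_apply, embed, Matrix.conjTranspose_apply, Matrix.of_apply, ite_mul,
      zero_mul, Finset.sum_ite_eq, Finset.mem_univ, if_true, apply_ite star, star_zero, mul_ite,
      mul_zero, star_prod, Finset.prod_mul_distrib]
    ring
  rw [Matrix.sum_apply]
  simp only [Matrix.smul_apply, h2, smul_eq_mul, Complex.ofReal_prod]
  rw [tensor, Matrix.of_apply, Fintype.prod_eq_mul_prod_subtype_ne _ i]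
  simp only [fun j : {j // j ≠ i} => h1 j, Fintype.prod_sum, Finset.mul_sum,
    Finset.prod_mul_distrib]
  exact Finset.sum_congr rfl fun k _ => by ring

/-- The partial trace may be computed in any orthonormal bases. -/
theorem marginal_eq_sum_embed (i : ι) {U : ∀ j, Matrix (d j) (d j) ℂ}
    (hU : ∀ j, U j * (U j)ᴴ = 1) (σ : Matrix (∀ j, d j) (∀ j, d j) ℂ) :
    marginal i σ = ∑ k : ∀ j : {j // j ≠ i}, d j, (embed i U k)ᴴ * σ * embed i U k := by
  ext α β
  have h1 : ∀ x y : ∀ j, d j, (∑ k : ∀ j : {j // j ≠ i}, d j,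
      star (embed i U k x α) * embed i U k y β) =
      if x i = α then (if y = Function.update x i β then 1 else 0) else 0 := by
    intro x y
    have h3 : ∑ k : ∀ j : {j // j ≠ i}, d j, star (∏ j : {j // j ≠ i}, U j (x j) (k j)) *
        (∏ j : {j // j ≠ i}, U j (y j) (k j)) =
        if ∀ j : {j // j ≠ i}, y j = x j then 1 else 0 := by
      simp only [star_prod, ← Finset.prod_mul_distrib]
      rw [← Fintype.prod_sum (fun (j : {j // j ≠ i}) l => star (U j (x j) l) * U j (y j) l)]
      have h4 : ∀ j : {j // j ≠ i}, ∑ l, star (U j (x j) l) * U j (y j) l =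
          if y j = x j then 1 else 0 := by
        intro j
        have := congrFun (congrFun (hU j) (y j)) (x j)
        rw [Matrix.mul_apply, Matrix.one_apply] at this
        rw [← this]
        exact Finset.sum_congr rfl fun l _ => by rw [Matrix.conjTranspose_apply, mul_comm]
      simp only [h4, Fintype.prod_ite_zero, Finset.prod_const_one]
    by_cases hx : x i = α
    · by_cases hy : y i = β
      · simp only [embed, Matrix.of_apply, if_pos hx, if_pos hy, h3]
        congr 1
        rw [Function.eq_update_iff]
        simp [hy]
      · have : y ≠ Function.update x i β := fun h => hy (by rw [h]; simp)
        simp [embed, hx, hy, this]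
    · simp [embed, hx]
  have h2 : (∑ k : ∀ j : {j // j ≠ i}, d j, (embed i U k)ᴴ * σ * embed i U k) α β =
      ∑ x, ∑ y, σ x y * ∑ k : ∀ j : {j // j ≠ i}, d j,
        star (embed i U k x α) * embed i U k y β := by
    simp only [Matrix.sum_apply, Matrix.mul_apply, Matrix.conjTranspose_apply, Finset.sum_mul,
      Finset.mul_sum]
    rw [Finset.sum_comm_cycle]
    refine Finset.sum_congr rfl fun x _ => ?_
    rw [Finset.sum_comm]
    refine Finset.sum_congr rfl fun y _ => Finset.sum_congr rfl fun k _ => ?_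
    ring
  rw [h2]
  simp only [h1]
  refine Finset.sum_congr rfl fun x _ => ?_
  by_cases hx : x i = α <;> simp [hx]

end Embedding

section RelativeEntropy

variable {ι : Type*} [Fintype ι] [DecidableEq ι] {d : ι → Type*} [∀ i, Fintype (d i)]
  [∀ i, DecidableEq (d i)]

theorem IsSpectral.trace_mul_log {n : Type*} [Fintype n] [DecidableEq n] {ρ U : Matrix n n ℂ}
    {r : n → ℝ} (h : IsSpectral ρ U r) :
    (ρ * _root_.cfc (Real.logb 2) ρ).trace.re = ∑ l, r l * Real.logb 2 (r l) := by
  rw [h.trace_mul, Complex.re_sum]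
  refine Finset.sum_congr rfl fun l _ => ?_
  rw [(h.cfc _).mulVec_col, dotProduct_smul, h.star_col_dotProduct_col]
  simp

/-- Monotonicity of the relative entropy under the partial trace, for a product state in the first
argument and an arbitrary state in the second. -/
theorem relEntropy_marginal_le {ρ : ∀ i, Matrix (d i) (d i) ℂ} (hρ : ∀ i, IsDensity (ρ i))
    {σ : Matrix (∀ i, d i) (∀ i, d i) ℂ} (hσ : σ.PosSemidef) (i : ι) :
    relEntropy (ρ i) (marginal i σ) ≤ relEntropy (tensor ρ) σ := by
  by_cases hker : ∀ v, σ *ᵥ v = 0 → tensor ρ *ᵥ v = 0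
  swap
  · rw [relEntropy.eq_1 (tensor ρ), if_neg hker]
    exact le_top
  choose U r hU using fun j => exists_isSpectral (hρ j).1.1
  have hr : ∀ j, ∑ l, r j l = 1 := by
    intro j
    have := (hρ j).2
    rw [(hU j).trace] at this
    exact_mod_cast this
  obtain ⟨hker', hle⟩ := ker_le_and_trace_mul_log_le (W := embed i U)
    (t := fun k => ∏ j : {j // j ≠ i}, r j (k j)) (embed_isometry i fun j => (hU j).left_inv)
    (fun k => Finset.prod_nonneg fun j _ => (hU j).nonneg (hρ j).1 _)
    (by rw [← Fintype.prod_sum (fun (j : {j // j ≠ i}) l => r j l)]; simp [hr])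
    (hρ i).1 hσ (tensor_eq_sum_embed i hU)
    (marginal_eq_sum_embed i (fun j => (hU j).right_inv) σ) hker
  rw [relEntropy, if_pos hker', relEntropy, if_pos hker, EReal.coe_le_coe_iff]
  rw [sum_prod_mul_logb_prod (fun (j : {j // j ≠ i}) l => r j l) fun j => hr j, (hρ i).2,
    Complex.one_re, one_mul] at hle
  have hself := trace_tensor_mul_log_tensor (σ := ρ) (fun j => (hρ j).2) (fun j => (hρ j).1.1)
    fun _ _ h => h
  rw [mul_sub, mul_sub, Matrix.trace_sub, Matrix.trace_sub, Complex.sub_re, Complex.sub_re, hself,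
    Complex.re_sum, Fintype.sum_eq_add_sum_subtype_ne _ i]
  simp only [fun j : {j // j ≠ i} => (hU j).trace_mul_log]
  linarith

/-- Adjoining the same states to both arguments does not increase the relative entropy. -/
theorem relEntropy_tensor_update_le {ρ : ∀ i, Matrix (d i) (d i) ℂ} (hρ : ∀ i, IsDensity (ρ i))
    (i : ι) {μ : Matrix (d i) (d i) ℂ} (hμ : IsDensity μ) :
    relEntropy (tensor ρ) (tensor (Function.update ρ i μ)) ≤ relEntropy (ρ i) μ := by
  by_cases hker : ∀ v, μ *ᵥ v = 0 → ρ i *ᵥ v = 0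
  swap
  · rw [relEntropy.eq_1 (ρ i), if_neg hker]
    exact le_top
  have hH : ∀ j, (Function.update ρ i μ j).IsHermitian := by
    intro j
    rcases eq_or_ne j i with rfl | hj
    · simpa using hμ.1.1
    · simpa [hj] using (hρ j).1.1
  have hk : ∀ j v, Function.update ρ i μ j *ᵥ v = 0 → ρ j *ᵥ v = 0 := by
    intro j v
    rcases eq_or_ne j i with rfl | hj
    · simpa using hker v
    · simp [hj]
  rw [relEntropy, if_pos (tensor_ker_le hH hk), relEntropy, if_pos hker, EReal.coe_le_coe_iff]
  have h1 := trace_tensor_mul_log_tensor (fun j => (hρ j).2) hH hk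
  have h2 := trace_tensor_mul_log_tensor (σ := ρ) (fun j => (hρ j).2) (fun j => (hρ j).1.1)
    fun _ _ h => h
  rw [mul_sub, mul_sub, Matrix.trace_sub, Matrix.trace_sub, h1, h2,
    Fintype.sum_eq_add_sum_subtype_ne _ i, Fintype.sum_eq_add_sum_subtype_ne _ i]
  simp [fun j : {j // j ≠ i} => Function.update_of_ne j.2 μ ρ]

/-- A set `M` lies at the relative entropy `D(ρ i ‖ S)` from `tensor ρ` as soon as its marginals
are in `S` and it contains the products of the elements of `S` with the remaining factors of
`tensor ρ`. -/
theorem relEntropySet_tensor_eq {ρ : ∀ i, Matrix (d i) (d i) ℂ} (hρ : ∀ i, IsDensity (ρ i))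
    (i : ι) {S : Set (Matrix (d i) (d i) ℂ)} (hS : ∀ μ ∈ S, IsDensity μ)
    {M : Set (Matrix (∀ i, d i) (∀ i, d i) ℂ)} (hM : ∀ σ ∈ M, σ.PosSemidef)
    (hmarg : ∀ σ ∈ M, marginal i σ ∈ S)
    (hprod : ∀ μ ∈ S, tensor (Function.update ρ i μ) ∈ M) :
    relEntropySet (tensor ρ) M = relEntropySet (ρ i) S := by
  refine le_antisymm (le_iInf₂ fun μ hμ => ?_) (le_iInf₂ fun σ hσ => ?_)
  · exact (iInf₂_le _ (hprod μ hμ)).trans (relEntropy_tensor_update_le hρ i (hS μ hμ))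
  · exact (iInf₂_le _ (hmarg σ hσ)).trans (relEntropy_marginal_le hρ (hM σ hσ) i)

end RelativeEntropy

end Composite

theorem mainTheorem6 {ι : Type*} [Fintype ι] [DecidableEq ι] {d : ι → Type*}
    [∀ i, Fintype (d i)] [∀ i, DecidableEq (d i)]
    (L : ∀ i, Composite.ResourceTheory (d i)) (T : Composite.ResourceTheory (∀ i, d i))
    (hT : Composite.IsComposite L T) (ρ : ∀ i, Matrix (d i) (d i) ℂ)
    (hρ : ∀ i, Composite.IsDensity (ρ i)) (i₀ : ι) (hfree : ∀ i, i ≠ i₀ → ρ i ∈ (L i).S) :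
    Composite.relEntropySet (Composite.tensor ρ) T.S =
        Composite.relEntropySet (ρ i₀) (L i₀).S ∧
      Composite.relEntropySet (Composite.tensor ρ) (Composite.Smax L) =
        Composite.relEntropySet (ρ i₀) (L i₀).S ∧
      (Convex ℝ (L i₀).S →
        Composite.relEntropySet (Composite.tensor ρ) (Composite.Smin L) =
          Composite.relEntropySet (ρ i₀) (L i₀).S) := by
  have hupd : ∀ μ ∈ (L i₀).S, ∀ i, Function.update ρ i₀ μ i ∈ (L i).S := by
    intro μ hμ i
    rcases eq_or_ne i i₀ with rfl | hi
    · simpa using hμ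
    · simpa [hi] using hfree i hi
  have hTmax : ∀ σ ∈ T.S, σ ∈ Composite.Smax L := fun σ hσ =>
    ⟨T.isDensity_of_mem σ hσ, hT.free_marginal_states σ hσ⟩
  refine ⟨?_, ?_, fun hconv => ?_⟩
  · exact Composite.relEntropySet_tensor_eq hρ i₀ (L i₀).isDensity_of_mem
      (fun σ hσ => (T.isDensity_of_mem σ hσ).1) (fun σ hσ => hT.free_marginal_states σ hσ i₀)
      fun μ hμ => hT.free_product_states _ (hupd μ hμ)
  · exact Composite.relEntropySet_tensor_eq hρ i₀ (L i₀).isDensity_of_mem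
      (fun σ hσ => hσ.1.1) (fun σ hσ => hσ.2 i₀)
      fun μ hμ => hTmax _ (hT.free_product_states _ (hupd μ hμ))
  · -- Positivity and a free `i₀`-th marginal are convex conditions satisfied by free products.
    have hmin : ∀ σ ∈ Composite.Smin L,
        σ ∈ {σ | σ.PosSemidef} ∩ (Composite.marginal i₀).restrictScalars ℝ ⁻¹' (L i₀).S := by
      intro σ hσ
      refine convexHull_min ?_ (Convex.inter ?_ (hconv.linear_preimage _)) hσ
      · rintro _ ⟨τ, hτ, rfl⟩
        have h := hT.free_product_states τ hτ
        exact ⟨(T.isDensity_of_mem _ h).1, hT.free_marginal_states _ h i₀⟩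
      · intro A hA B hB a b ha hb _
        exact (hA.smul ha).add (hB.smul hb)
    exact Composite.relEntropySet_tensor_eq hρ i₀ (L i₀).isDensity_of_mem
      (fun σ hσ => (hmin σ hσ).1) (fun σ hσ => (hmin σ hσ).2)
      fun μ hμ => subset_convexHull ℝ _ ⟨_, hupd μ hμ, rfl⟩
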